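/- Let $\mathcal{C}$ be a noetherian integral domain, let $n\ge 1$, $x=(x_1,\dots,x_n)$, and let $\preceq$ be an arbitrary monomial order on $\mathbb{N}^n$, that is, a total order such that $\alpha\prec\beta$ implies $\alpha+\gamma\prec\beta+\gamma$ (it need not be a well-ordering). For a nonzero polynomial $f$ in $x$, let $\exp_\preceq(f)\in\mathbb{N}^n$ denote the $\preceq$-largest exponent of a monomial occurring in $f$ with nonzero coefficient. For a field $\mathbf{K}$ and a nonzero ideal $L\subset\mathbf{K}[x]$, a finite set $G\subset L$ is a $\preceq$-standard basis of $L$ if $\{\exp_\preceq(f) : f\in L\setminus\{0\}\}=\bigcup_{g\in G}(\exp_\preceq(g)+\mathbb{N}^n)$. A specialization of $\mathcal{C}$ is a ring homomorphism $\sigma:\mathcal{C}\to\mathbf{K}$ to a field; the induced homomorphism $\mathcal{C}[x]\to\mathbf{K}[x]$ is again denoted $\sigma$. For $S\subset\mathcal{C}$, $V(S)$ is the set of prime ideals of $\mathcal{C}$ containing $S$. Let $J\subset\mathcal{C}[x]$ be a finitely generated ideal. Then there exist finitely many triples $(\mathcal{G}_k,\mathcal{Q}_k,h_k)$, with $\mathcal{G}_k\subset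 J$ a finite set, $\mathcal{Q}_k\subset\mathcal{C}$ an ideal and $h_k\in\mathcal{C}$, and there exists an ideal $\mathcal{I}\subset\mathcal{C}$, such that: 1. $\mathrm{Spec}(\mathcal{C})=\bigcup_k\bigl(V(\mathcal{Q}_k)\setminus V(h_k)\bigr)\cup V(\mathcal{I})$; 2. for every specialization $\sigma$ of $\mathcal{C}$, if $\sigma(\mathcal{I})=\{0\}$ then $\sigma(J)=\{0\}$; 3. for every $k$, every field $\mathbf{K}$ and every specialization $\sigma:\mathcal{C}\to\mathbf{K}$ with $\sigma(\mathcal{Q}_k)=\{0\}$ and $\sigma(h_k)\neq 0$: - $\sigma(J)\neq\{0\}$; - $\sigma(\mathcal{G}_k)$ is a $\preceq$-standard basis of the ideal $\mathbf{K}[x]\sigma(J)$; - for each $g\in\mathcal{G}_k$, $\sigma(g)\ne 0$ and $\exp_\preceq(\sigma(g))$ does not depend on $\sigma$ (nor on $\mathbf{K}$). -/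

import Mathlib

namespace ParamStdBasis

/-- A monomial order on `n` variables: a total order `⪯` on exponents `α ∈ ℕⁿ` whose strict part
is compatible with addition. It is *not* assumed to be a well-ordering. -/
structure MonOrder (n : ℕ) where
  /-- the relation `α ⪯ β` -/
  le : (Fin n →₀ ℕ) → (Fin n →₀ ℕ) → Prop
  le_refl : ∀ α, le α α
  le_trans : ∀ α β γ, le α β → le β γ → le α γ
  le_antisymm : ∀ α β, le α β → le β α → α = β
  le_total : ∀ α β, le α β ∨ le β α
  add_lt_add : ∀ α β γ, (le α β ∧ α ≠ β) → (le (α + γ) (β + γ) ∧ α + γ ≠ β + γ)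

/-- `α` is the leading exponent `exp(f)`: the `⪯`-greatest element of the support of `f`.
In particular `f ≠ 0`. -/
def IsLeadingExp {n : ℕ} (ord : MonOrder n) {R : Type*} [CommRing R]
    (f : MvPolynomial (Fin n) R) (α : Fin n →₀ ℕ) : Prop :=
  α ∈ f.support ∧ ∀ β ∈ f.support, ord.le β α

/-- `Exp(I)`, the set of leading exponents of the nonzero elements of the ideal `I`. -/
def expSet {n : ℕ} (ord : MonOrder n) {R : Type*} [CommRing R]
    (I : Ideal (MvPolynomial (Fin n) R)) : Set (Fin n →₀ ℕ) :=
  {α | ∃ f ∈ I, f ≠ 0 ∧ IsLeadingExp ord f α}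

/-- A finite set `G` is a standard basis of the ideal `I` of `K[x]` if `G ⊆ I` and
`Exp(I) = ⋃_{g ∈ G} (exp(g) + ℕⁿ)`. -/
def IsStandardBasis {n : ℕ} (ord : MonOrder n) {K : Type*} [Field K]
    (I : Ideal (MvPolynomial (Fin n) K)) (G : Set (MvPolynomial (Fin n) K)) : Prop :=
  G.Finite ∧ G ⊆ I ∧
    expSet ord I = {α | ∃ g ∈ G, ∃ β γ : Fin n →₀ ℕ, IsLeadingExp ord g β ∧ α = β + γ}

/-- `σ` belongs to the stratum of `(Q, h)`: `σ(Q) = {0}` and `σ(h) ≠ 0`. -/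
def InStratum {C K : Type*} [CommRing C] [Field K] (Q : Ideal C) (h : C) (σ : C →+* K) : Prop :=
  (∀ a ∈ Q, σ a = 0) ∧ σ h ≠ 0

end ParamStdBasis

universe u v

/-!
Every irreducible closed subset `V(Q)` of the spectrum contains a nonempty open subset over which
the specializations of `J` have a common standard basis; noetherian induction on closed subsets
then gives the finite covering (`exists_finite_strata_cover`).

Since the order need not be a well-ordering, division with remainder need not terminate in
`K[x]`. The remedy is homogenization, realized without an extra variable: with `A` a finite set of
generators of `J`, the submodule `degreeSpan A d` of combinations of `A` with coefficients of
degree at most `d` is supported on finitely many monomials, and the ideal is the union of these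
submodules.

Fix a prime `Q` and call an exponent *attained in step `d`* if it is the leading exponent modulo
`Q` of an element of `degreeSpan A d`. The pairs of an attained exponent and the matching exponent
of the homogenizing variable lie in `ℕ × ℕⁿ`, so by Dickson's lemma (`exists_finset_leadingExp`)
there are finitely many `g ∈ J` whose monomial multiples, taken within step `d`, attain every
exponent attained in step `d`, for all `d`. Let `h` be the product of their leading coefficients
modulo `Q`, so that `h ∉ Q`. For a specialization `σ` with `σ(Q) = 0` and `σ(h) ≠ 0`, these
multiples keep their leading exponents. Moreover they span the specialization of
`degreeSpan A d` over `K` (`map_mem_span_of_leadingExp`): for `f` in `degreeSpan A d`, a leading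
term modulo `Q` can be cancelled after multiplication by an element that `σ` makes invertible, and
what is left over in the end has coefficients in `Q`, hence is killed by `σ`. A nonzero combination
of polynomials with distinct leading exponents has one of these as its leading exponent, so
specialization creates no new leading exponents. This replaces Buchberger's criterion.
-/

namespace ParamStdBasis

open MvPolynomial

/-! ### Leading exponents -/

section LeadingExp

variable {n : ℕ} (ord : MonOrder n)

lemma MonOrder.exists_max (s : Finset (Fin n →₀ ℕ)) (hs : s.Nonempty) :
    ∃ α ∈ s, ∀ β ∈ s, ord.le β α := by
  induction hs using Finset.Nonempty.cons_induction with
  | singleton a => exact ⟨a, by simp, by simp [ord.le_refl]⟩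
  | cons a s ha hs ih =>
    obtain ⟨α, hα, hmax⟩ := ih
    rcases ord.le_total a α with h | h
    · refine ⟨α, by simp [hα], fun β hβ => ?_⟩
      rcases Finset.mem_cons.1 hβ with rfl | hβ
      exacts [h, hmax β hβ]
    · refine ⟨a, by simp, fun β hβ => ?_⟩
      rcases Finset.mem_cons.1 hβ with rfl | hβ
      exacts [ord.le_refl _, ord.le_trans _ _ _ (hmax β hβ) h]

lemma MonOrder.add_le_add_left {α β : Fin n →₀ ℕ} (h : ord.le α β) (γ : Fin n →₀ ℕ) :
    ord.le (γ + α) (γ + β) := by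
  by_cases hαβ : α = β
  · exact hαβ ▸ ord.le_refl _
  · simpa only [add_comm γ] using (ord.add_lt_add α β γ ⟨h, hαβ⟩).1

variable {ord}

lemma exists_isLeadingExp {R : Type*} [CommRing R] {f : MvPolynomial (Fin n) R} (hf : f ≠ 0) :
    ∃ α, IsLeadingExp ord f α :=
  ord.exists_max f.support (support_nonempty.2 hf)

lemma IsLeadingExp.unique {R : Type*} [CommRing R] {f : MvPolynomial (Fin n) R}
    {α β : Fin n →₀ ℕ} (hα : IsLeadingExp ord f α) (hβ : IsLeadingExp ord f β) : α = β :=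
  ord.le_antisymm _ _ (hβ.2 _ hα.1) (hα.2 _ hβ.1)

lemma IsLeadingExp.ne_zero {R : Type*} [CommRing R] {f : MvPolynomial (Fin n) R}
    {α : Fin n →₀ ℕ} (hα : IsLeadingExp ord f α) : f ≠ 0 := by
  rintro rfl
  simpa using hα.1

lemma IsLeadingExp.monomial_mul {R : Type*} [CommRing R] {f : MvPolynomial (Fin n) R}
    {α : Fin n →₀ ℕ} (hα : IsLeadingExp ord f α) (γ : Fin n →₀ ℕ) :
    IsLeadingExp ord (monomial γ 1 * f) (γ + α) := by
  refine ⟨by simpa using hα.1, fun β hβ => ?_⟩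
  rw [mem_support_iff, coeff_monomial_mul'] at hβ
  obtain ⟨hγ, hne⟩ := ite_ne_right_iff.1 hβ
  rw [one_mul, ← mem_support_iff] at hne
  simpa [add_tsub_cancel_of_le hγ] using ord.add_le_add_left (hα.2 _ hne) γ

/-- A leading exponent survives every specialization whose kernel is at least as large and which
does not kill the leading coefficient. -/
lemma IsLeadingExp.map_of_ker_le {C R K : Type*} [CommRing C] [CommRing R] [CommRing K]
    {φ : C →+* R} {σ : C →+* K} (hker : RingHom.ker φ ≤ RingHom.ker σ)
    {g : MvPolynomial (Fin n) C} {α : Fin n →₀ ℕ} (hα : IsLeadingExp ord (map φ g) α)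
    (hσ : σ (g.coeff α) ≠ 0) : IsLeadingExp ord (map σ g) α := by
  refine ⟨by simpa [coeff_map] using hσ, fun β hβ => hα.2 β ?_⟩
  rw [mem_support_iff, coeff_map] at hβ ⊢
  exact fun h => hβ (hker h)

/-- The leading exponent of a nonzero linear combination of polynomials with pairwise distinct
leading exponents is one of those exponents. -/
lemma mem_of_isLeadingExp_of_mem_span {K : Type*} [Field K] {S : Set (Fin n →₀ ℕ)}
    {b : S → MvPolynomial (Fin n) K} (hb : ∀ α : S, IsLeadingExp ord (b α) α)
    {y : MvPolynomial (Fin n) K} (hy : y ∈ Submodule.span K (Set.range b))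
    {β : Fin n →₀ ℕ} (hβ : IsLeadingExp ord y β) : β ∈ S := by
  obtain ⟨c, rfl⟩ := Finsupp.mem_span_range_iff_exists_finsupp.1 hy
  have hc : c ≠ 0 := by
    rintro rfl
    exact hβ.ne_zero (by simp)
  obtain ⟨α, hα, hmax⟩ := ord.exists_max (c.support.image Subtype.val)
    ((Finsupp.support_nonempty_iff.2 hc).image _)
  obtain ⟨a, ha, rfl⟩ := Finset.mem_image.1 hα
  suffices h : IsLeadingExp ord (c.sum fun i x => x • b i) a from hβ.unique h ▸ a.2
  have hle : ∀ i ∈ c.support, ord.le i a := fun i hi =>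
    hmax _ (Finset.mem_image_of_mem _ hi)
  constructor
  · rw [mem_support_iff, Finsupp.sum, coeff_sum, Finset.sum_eq_single_of_mem a ha]
    · simpa using ⟨Finsupp.mem_support_iff.1 ha, mem_support_iff.1 (hb a).1⟩
    · intro i hi hia
      rw [coeff_smul, notMem_support_iff.1, smul_zero]
      exact fun h => hia (Subtype.ext (ord.le_antisymm _ _ (hle i hi) ((hb i).2 _ h)))
  · intro γ hγ
    rw [mem_support_iff, Finsupp.sum, coeff_sum] at hγ
    obtain ⟨i, hi, hne⟩ := Finset.exists_ne_zero_of_sum_ne_zero hγ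
    refine ord.le_trans _ _ _ ((hb i).2 γ ?_) (hle i hi)
    rw [mem_support_iff]
    rintro h
    exact hne (by rw [coeff_smul, h, smul_zero])

end LeadingExp

/-! ### Leading exponents of a specialized module -/

section Specialization

variable {n : ℕ} {ord : MonOrder n} {C R K : Type*} [CommRing C] [CommRing R] [Field K]
  {φ : C →+* R} {σ : C →+* K} {N : Submodule C (MvPolynomial (Fin n) C)}

/-- The reduction step. The finite set `T` bounding the supports makes up for the order not being
a well-ordering: it makes the successive cancellation of leading terms terminate. -/
lemma map_mem_span_of_leadingExp (hker : RingHom.ker φ ≤ RingHom.ker σ)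
    {T : Set (Fin n →₀ ℕ)} (hT : T.Finite) (hN : ∀ f ∈ N, ∀ β ∈ f.support, β ∈ T)
    {S : Set (Fin n →₀ ℕ)} (b : S → MvPolynomial (Fin n) C)
    (hS : ∀ f ∈ N, ∀ α, IsLeadingExp ord (map φ f) α → α ∈ S)
    (hbN : ∀ α, b α ∈ N) (hb : ∀ α, IsLeadingExp ord (map φ (b α)) α)
    (hσ : ∀ α : S, σ ((b α).coeff α) ≠ 0) {f : MvPolynomial (Fin n) C} (hf : f ∈ N) :
    map σ f ∈ Submodule.span K (Set.range fun α => map σ (b α)) := by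
  classical
  -- `k` bounds the number of exponents of `T` lying below the leading exponent of `map φ f`.
  suffices H : ∀ k : ℕ, ∀ f ∈ N,
      (∀ α, IsLeadingExp ord (map φ f) α → (hT.toFinset.filter (ord.le · α)).card < k) →
      map σ f ∈ Submodule.span K (Set.range fun α => map σ (b α)) from
    H (hT.toFinset.card + 1) f hf fun α _ =>
      Nat.lt_succ_of_le (Finset.card_le_card (Finset.filter_subset _ _))
  intro k
  induction k with
  | zero =>
    intro f _ hlt
    have h0 : map φ f = 0 := by
      by_contra h
      obtain ⟨α, hα⟩ := exists_isLeadingExp (ord := ord) h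
      exact absurd (hlt α hα) (Nat.not_lt_zero _)
    have : map σ f = 0 := by
      ext β
      have := congrArg (coeff β) h0
      rw [coeff_map, coeff_zero] at this ⊢
      exact hker this
    rw [this]
    exact zero_mem _
  | succ k ih =>
    intro f hf hlt
    by_cases h0 : ∃ α, IsLeadingExp ord (map φ f) α
    swap
    · exact ih f hf fun α hα => absurd ⟨α, hα⟩ h0
    obtain ⟨α, hα⟩ := h0
    set a : S := ⟨α, hS f hf α hα⟩ with ha
    have hba := hb a
    set u : C := (b a).coeff α with hu
    set r : MvPolynomial (Fin n) C := u • f - f.coeff α • b a with hr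
    have hrN : r ∈ N := N.sub_mem (N.smul_mem _ hf) (N.smul_mem _ (hbN a))
    have hrα : r.coeff α = 0 := by
      rw [hr, coeff_sub, coeff_smul, coeff_smul, ← hu, smul_eq_mul, smul_eq_mul, mul_comm, sub_self]
    have hr_le : ∀ β ∈ (map φ r).support, ord.le β α := by
      intro β hβ
      by_contra hle
      have h1 : φ (f.coeff β) = 0 := by
        rw [← coeff_map]; exact notMem_support_iff.1 fun h => hle (hα.2 β h)
      have h2 : φ ((b a).coeff β) = 0 := by
        rw [← coeff_map]; exact notMem_support_iff.1 fun h => hle (hba.2 β h)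
      rw [mem_support_iff, coeff_map] at hβ
      exact hβ (by simp [hr, h1, h2])
    have key : map σ r ∈ Submodule.span K (Set.range fun α => map σ (b α)) := by
      refine ih r hrN fun β hβ => ?_
      have hβα : ord.le β α := hr_le β hβ.1
      have hne : β ≠ α := by
        rintro rfl
        exact mem_support_iff.1 hβ.1 (by rw [coeff_map, hrα, map_zero])
      refine lt_of_lt_of_le (Finset.card_lt_card ?_) (Nat.lt_succ_iff.1 (hlt α hα))
      rw [Finset.ssubset_iff_of_subset]
      · refine ⟨α, ?_, ?_⟩
        · rw [Finset.mem_filter, hT.mem_toFinset]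
          exact ⟨hN f hf α (support_map_subset φ f hα.1), ord.le_refl α⟩
        · rw [Finset.mem_filter]
          exact fun h => hne (ord.le_antisymm _ _ hβα h.2)
      · intro δ hδ
        rw [Finset.mem_filter] at hδ ⊢
        exact ⟨hδ.1, ord.le_trans _ _ _ hδ.2 hβα⟩
    have hu0 : σ u ≠ 0 := hσ a
    have hf_eq : map σ f = (σ u)⁻¹ • (map σ r + σ (f.coeff α) • map σ (b a)) := by
      have : map σ r = σ u • map σ f - σ (f.coeff α) • map σ (b a) := by
        simp [hr, smul_eq_C_mul]
      rw [this, sub_add_cancel, smul_smul, inv_mul_cancel₀ hu0, one_smul]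
    rw [hf_eq]
    exact Submodule.smul_mem _ _ (Submodule.add_mem _ key
      (Submodule.smul_mem _ _ (Submodule.subset_span ⟨a, rfl⟩)))

/-- If every leading exponent of `N` along `φ` is attained by an element of `N` whose leading
coefficient is not killed by `σ`, then the `K`-span of the image of `N` under `σ` has no further
leading exponents. -/
lemma exists_isLeadingExp_of_mem_span_map (hker : RingHom.ker φ ≤ RingHom.ker σ)
    {T : Set (Fin n →₀ ℕ)} (hT : T.Finite) (hN : ∀ f ∈ N, ∀ β ∈ f.support, β ∈ T)
    (hlead : ∀ f ∈ N, ∀ α, IsLeadingExp ord (map φ f) α →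
      ∃ b ∈ N, IsLeadingExp ord (map φ b) α ∧ σ (b.coeff α) ≠ 0)
    {y : MvPolynomial (Fin n) K} (hy : y ∈ Submodule.span K (map σ '' (N : Set _)))
    {α : Fin n →₀ ℕ} (hα : IsLeadingExp ord y α) :
    ∃ b ∈ N, IsLeadingExp ord (map φ b) α := by
  let S : Set (Fin n →₀ ℕ) := {α | ∃ f ∈ N, IsLeadingExp ord (map φ f) α}
  have hex : ∀ α : S, ∃ b ∈ N, IsLeadingExp ord (map φ b) α ∧ σ (b.coeff α) ≠ 0 :=
    fun ⟨α, f, hf, hfα⟩ => hlead f hf α hfα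
  choose b hbN hb hσ using hex
  refine mem_of_isLeadingExp_of_mem_span (S := S) (b := fun α => map σ (b α))
    (fun α => (hb α).map_of_ker_le hker (hσ α)) (Submodule.span_le.2 ?_ hy) hα
  rintro _ ⟨f, hf, rfl⟩
  exact map_mem_span_of_leadingExp hker hT hN b (fun f hf α hα => ⟨f, hf, hα⟩) hbN hb hσ hf

end Specialization

/-! ### The degree filtration of an ideal -/

section Filtration

variable {n : ℕ}

/-- The `d`-th step of the filtration of the ideal generated by `A`: the combinations of elements
of `A` whose coefficients are polynomials of degree at most `d`. It plays the role of a homogeneous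
component of the homogenized ideal. -/
noncomputable def degreeSpan {R : Type*} [CommRing R] (A : Set (MvPolynomial (Fin n) R)) (d : ℕ) :
    Submodule R (MvPolynomial (Fin n) R) :=
  Submodule.span R {p | ∃ γ : Fin n →₀ ℕ, γ.degree ≤ d ∧ ∃ f ∈ A, p = monomial γ 1 * f}

variable {R : Type*} [CommRing R] {A : Set (MvPolynomial (Fin n) R)}

lemma degreeSpan_mono {d e : ℕ} (h : d ≤ e) : degreeSpan A d ≤ degreeSpan A e :=
  Submodule.span_mono fun _ ⟨γ, hγ, hp⟩ => ⟨γ, hγ.trans h, hp⟩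

lemma monomial_mul_mem_degreeSpan {d : ℕ} {f : MvPolynomial (Fin n) R} (hf : f ∈ degreeSpan A d)
    (γ : Fin n →₀ ℕ) (r : R) : monomial γ r * f ∈ degreeSpan A (γ.degree + d) := by
  induction hf using Submodule.span_induction with
  | mem x hx =>
    obtain ⟨δ, hδ, f, hf, rfl⟩ := hx
    have : monomial γ r * (monomial δ 1 * f) = r • (monomial (γ + δ) 1 * f) := by
      rw [← mul_assoc, monomial_mul, ← smul_mul_assoc, smul_monomial, smul_eq_mul]
    rw [this]
    refine Submodule.smul_mem _ _ (Submodule.subset_span ⟨γ + δ, ?_, f, hf, rfl⟩)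
    rw [map_add]
    omega
  | zero => simp
  | add x y _ _ hx hy => rw [mul_add]; exact add_mem hx hy
  | smul a x _ hx => rw [mul_smul_comm]; exact Submodule.smul_mem _ _ hx

lemma degreeSpan_le_span (A : Set (MvPolynomial (Fin n) R)) (d : ℕ) :
    degreeSpan A d ≤ (Ideal.span A).restrictScalars R :=
  Submodule.span_le.2 fun _ ⟨_, _, _, hf, hp⟩ =>
    hp ▸ Ideal.mul_mem_left _ _ (Ideal.subset_span hf)

lemma exists_mem_degreeSpan {f : MvPolynomial (Fin n) R} (hf : f ∈ Ideal.span A) :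
    ∃ d, f ∈ degreeSpan A d := by
  have hadd : ∀ x y : MvPolynomial (Fin n) R, (∃ d, x ∈ degreeSpan A d) →
      (∃ d, y ∈ degreeSpan A d) → ∃ d, x + y ∈ degreeSpan A d := fun x y ⟨d, hd⟩ ⟨e, he⟩ =>
    ⟨max d e, add_mem (degreeSpan_mono (le_max_left _ _) hd)
      (degreeSpan_mono (le_max_right _ _) he)⟩
  induction hf using Submodule.span_induction with
  | mem x hx => exact ⟨0, Submodule.subset_span ⟨0, by simp, x, hx, by simp⟩⟩
  | zero => exact ⟨0, zero_mem _⟩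
  | add x y _ _ hx hy => exact hadd x y hx hy
  | smul a x _ hx =>
    obtain ⟨d, hd⟩ := hx
    induction a using MvPolynomial.induction_on' with
    | monomial γ r => exact ⟨_, monomial_mul_mem_degreeSpan hd γ r⟩
    | add p q hp hq => rw [add_smul]; exact hadd _ _ hp hq

lemma exists_degree_bound (A : Finset (MvPolynomial (Fin n) R)) :
    ∃ D : ℕ, ∀ d, ∀ f ∈ degreeSpan (A : Set (MvPolynomial (Fin n) R)) d, ∀ β ∈ f.support,
      β.degree ≤ d + D := by
  classical
  refine ⟨A.sup fun f => f.support.sup fun β => β.degree, fun d f hf => ?_⟩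
  induction hf using Submodule.span_induction with
  | mem x hx =>
    obtain ⟨γ, hγ, f, hf, rfl⟩ := hx
    intro β hβ
    rw [mem_support_iff, coeff_monomial_mul'] at hβ
    obtain ⟨hle, hne⟩ := ite_ne_right_iff.1 hβ
    rw [one_mul, ← mem_support_iff] at hne
    have h1 : (β - γ).degree ≤ A.sup fun f => f.support.sup fun β => β.degree :=
      (Finset.le_sup (f := fun β : Fin n →₀ ℕ => β.degree) hne).trans
        (Finset.le_sup (f := fun f : MvPolynomial (Fin n) R => f.support.sup fun β => β.degree) hf)
    rw [← add_tsub_cancel_of_le hle, map_add]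
    omega
  | zero => simp
  | add x y _ _ hx hy =>
    intro β hβ
    rcases Finset.mem_union.1 (support_add hβ) with h | h
    exacts [hx β h, hy β h]
  | smul a x _ hx => exact fun β hβ => hx β (support_smul hβ)

lemma degreeSpan_image_le {K : Type*} [CommRing K] (σ : R →+* K) (d : ℕ) :
    degreeSpan (map σ '' A) d ≤ Submodule.span K (map σ '' (degreeSpan A d : Set _)) := by
  refine Submodule.span_mono ?_
  rintro _ ⟨γ, hγ, _, ⟨f, hf, rfl⟩, rfl⟩
  exact ⟨monomial γ 1 * f, Submodule.subset_span ⟨γ, hγ, f, hf, rfl⟩, by simp⟩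

end Filtration

/-! ### Generic standard bases -/

section Generic

variable {n : ℕ} (ord : MonOrder n)

/-- Dickson's lemma, applied to the leading exponents along `φ` of all steps of the filtration
at once: finitely many `g` suffice to attain all of them by monomial multiples that stay in the
prescribed step. -/
lemma exists_finset_leadingExp {C R : Type*} [CommRing C] [CommRing R] (φ : C →+* R)
    (A : Finset (MvPolynomial (Fin n) C)) :
    ∃ P : Finset (MvPolynomial (Fin n) C × (Fin n →₀ ℕ)),
      (∀ p ∈ P, p.1 ∈ Ideal.span (A : Set (MvPolynomial (Fin n) C)) ∧
        IsLeadingExp ord (map φ p.1) p.2) ∧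
      ∀ d, ∀ f ∈ degreeSpan (A : Set (MvPolynomial (Fin n) C)) d, ∀ α,
        IsLeadingExp ord (map φ f) α → ∃ p ∈ P, ∃ γ : Fin n →₀ ℕ, α = γ + p.2 ∧
          monomial γ 1 * p.1 ∈ degreeSpan (A : Set (MvPolynomial (Fin n) C)) d := by
  classical
  obtain ⟨D, hD⟩ := exists_degree_bound A
  -- `e` records the exponent of the homogenizing variable: it is the difference between the
  -- degree bound `d + D` of the filtration step and the degree of the leading exponent.
  let E : Set (ℕ × (Fin n →₀ ℕ)) := {q | ∃ d, q.1 + q.2.degree = d + D ∧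
    ∃ f ∈ degreeSpan (A : Set (MvPolynomial (Fin n) C)) d, IsLeadingExp ord (map φ f) q.2}
  have hpwo : E.IsPWO := Set.isPWO_of_wellQuasiOrderedLE E
  have hfin : {q | Minimal (· ∈ E) q}.Finite :=
    WellQuasiOrderedLE.finite_of_isAntichain (setOfPred_minimal_antichain _)
  choose! d hd f hf hlead using fun q (hq : q ∈ E) => hq
  refine ⟨hfin.toFinset.image fun q => (f q, q.2), ?_, ?_⟩
  · intro p hp
    obtain ⟨q, hq, rfl⟩ := Finset.mem_image.1 hp
    have hqE : q ∈ E := (hfin.mem_toFinset.1 hq).1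
    exact ⟨degreeSpan_le_span _ _ (hf q hqE), hlead q hqE⟩
  · intro d' f' hf' α hα
    have hdeg : α.degree ≤ d' + D := hD d' f' hf' α (support_map_subset φ f' hα.1)
    have hmem : (d' + D - α.degree, α) ∈ E :=
      ⟨d', Nat.sub_add_cancel hdeg, f', hf', hα⟩
    obtain ⟨q, hqle, hq⟩ := hpwo.exists_le_minimal hmem
    have h1 : q.1 ≤ d' + D - α.degree := hqle.1
    have h2 : q.2 ≤ α := hqle.2
    refine ⟨(f q, q.2), Finset.mem_image_of_mem _ (hfin.mem_toFinset.2 hq), α - q.2,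
      (tsub_add_cancel_of_le h2).symm, degreeSpan_mono ?_
        (monomial_mul_mem_degreeSpan (hf q hq.1) (α - q.2) 1)⟩
    have h3 : (α - q.2).degree + q.2.degree = α.degree := by
      rw [← map_add, tsub_add_cancel_of_le h2]
    have h4 := hd q hq.1
    omega

/-- Along every specialization `σ` that contains the kernel of `φ` and does not kill the leading
coefficients, the polynomials attaining the leading exponents along `φ` specialize to a standard
basis. -/
lemma isStandardBasis_map {C R K : Type*} [CommRing C] [CommRing R] [Field K] {φ : C →+* R}
    {σ : C →+* K} (hker : RingHom.ker φ ≤ RingHom.ker σ) {A : Finset (MvPolynomial (Fin n) C)}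
    {P : Finset (MvPolynomial (Fin n) C × (Fin n →₀ ℕ))}
    (hP : ∀ p ∈ P, p.1 ∈ Ideal.span (A : Set (MvPolynomial (Fin n) C)) ∧
      IsLeadingExp ord (map φ p.1) p.2)
    (hPA : ∀ d, ∀ f ∈ degreeSpan (A : Set (MvPolynomial (Fin n) C)) d, ∀ α,
      IsLeadingExp ord (map φ f) α → ∃ p ∈ P, ∃ γ : Fin n →₀ ℕ, α = γ + p.2 ∧
        monomial γ 1 * p.1 ∈ degreeSpan (A : Set (MvPolynomial (Fin n) C)) d)
    (hσ : ∀ p ∈ P, σ (p.1.coeff p.2) ≠ 0) :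
    IsStandardBasis ord ((Ideal.span (A : Set (MvPolynomial (Fin n) C))).map (map σ))
      (map σ '' (Prod.fst '' (P : Set (MvPolynomial (Fin n) C × (Fin n →₀ ℕ))))) := by
  have hmem : map σ '' (Prod.fst '' (P : Set (MvPolynomial (Fin n) C × (Fin n →₀ ℕ)))) ⊆
      (Ideal.span (A : Set (MvPolynomial (Fin n) C))).map (map σ) := by
    rintro _ ⟨_, ⟨p, hp, rfl⟩, rfl⟩
    exact Ideal.mem_map_of_mem _ (hP p hp).1
  refine ⟨(P.finite_toSet.image _).image _, hmem, Set.Subset.antisymm ?_ ?_⟩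
  · rintro α ⟨y, hy, -, hα⟩
    rw [Ideal.map_span] at hy
    obtain ⟨d, hd⟩ := exists_mem_degreeSpan hy
    obtain ⟨D, hD⟩ := exists_degree_bound A
    obtain ⟨b, hb, hbα⟩ := exists_isLeadingExp_of_mem_span_map hker
      (Finsupp.finite_of_degree_le (d + D)) (hD d) (fun f hf β hβ => by
        obtain ⟨p, hp, γ, rfl, hpd⟩ := hPA d f hf β hβ
        refine ⟨_, hpd, ?_, ?_⟩
        · simpa using (hP p hp).2.monomial_mul γ
        · simpa using hσ p hp) (degreeSpan_image_le σ d hd) hα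
    obtain ⟨p, hp, γ, rfl, -⟩ := hPA d b hb α hbα
    exact ⟨map σ p.1, ⟨p.1, ⟨p, hp, rfl⟩, rfl⟩, p.2, γ,
      (hP p hp).2.map_of_ker_le hker (hσ p hp), add_comm _ _⟩
  · rintro _ ⟨g, hg, β, γ, hβ, rfl⟩
    have h := hβ.monomial_mul γ
    exact ⟨monomial γ 1 * g, Ideal.mul_mem_left _ _ (hmem hg), h.ne_zero, add_comm β γ ▸ h⟩

end Generic

/-! ### Strata -/

section Strata

variable {n : ℕ} (ord : MonOrder n) {C : Type u} [CommRing C] (J : Ideal (MvPolynomial (Fin n) C))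

/-- `(G, Q, h)` is an admissible stratum for `J`: along every specialization to a field in the
universe `v` that lies in the stratum of `(Q, h)`, the ideal `J` does not vanish and `G ⊆ J`
specializes to a standard basis with constant leading exponents. -/
def IsStdStratum (G : Finset (MvPolynomial (Fin n) C)) (Q : Ideal C) (h : C) : Prop :=
  (∀ g ∈ G, g ∈ J) ∧
  (∀ (K : Type v) [Field K] (σ : C →+* K), InStratum Q h σ →
    (∃ f ∈ J, map σ f ≠ 0) ∧
    IsStandardBasis ord (J.map (map σ)) (map σ '' (G : Set (MvPolynomial (Fin n) C)))) ∧
  (∀ g ∈ G, ∃ α : Fin n →₀ ℕ, ∀ (K : Type v) [Field K] (σ : C →+* K),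
    InStratum Q h σ → IsLeadingExp ord (map σ g) α)

/-- The ideal generated by all coefficients of the elements of `J`; its zero locus consists of the
points at which `J` specializes to zero. -/
def coeffIdeal : Ideal C := Ideal.span {c | ∃ f ∈ J, ∃ α, c = f.coeff α}

variable {J}

lemma coeff_mem_coeffIdeal {f : MvPolynomial (Fin n) C} (hf : f ∈ J) (α : Fin n →₀ ℕ) :
    f.coeff α ∈ coeffIdeal J :=
  Ideal.subset_span ⟨f, hf, α, rfl⟩

/-- At a prime `Q` where `J` does not vanish there is a stratum that is a nonempty open subset of
`V(Q)`. -/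
lemma exists_isStdStratum (hJ : J.FG) (Q : Ideal C) [Q.IsPrime] (hQ : ¬ coeffIdeal J ≤ Q) :
    ∃ (G : Finset (MvPolynomial (Fin n) C)) (h : C), h ∉ Q ∧ IsStdStratum.{u, v} ord J G Q h := by
  classical
  obtain ⟨A, rfl⟩ := hJ
  set φ := Ideal.Quotient.mk Q with hφ
  obtain ⟨P, hP, hPA⟩ := exists_finset_leadingExp ord φ A
  have hne : P.Nonempty := by
    by_contra hempty
    refine hQ (Ideal.span_le.2 ?_)
    rintro _ ⟨f, hf, α, rfl⟩
    by_contra hα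
    have h0 : map φ f ≠ 0 := fun h =>
      hα (Ideal.Quotient.eq_zero_iff_mem.1 (by rw [← hφ, ← coeff_map, h, coeff_zero]))
    obtain ⟨β, hβ⟩ := exists_isLeadingExp (ord := ord) h0
    obtain ⟨d, hd⟩ := exists_mem_degreeSpan hf
    obtain ⟨p, hp, -⟩ := hPA d f hd β hβ
    exact hempty ⟨p, hp⟩
  have hstr : ∀ (K : Type v) [Field K] (σ : C →+* K),
      InStratum Q (∏ p ∈ P, p.1.coeff p.2) σ →
      RingHom.ker φ ≤ RingHom.ker σ ∧ ∀ p ∈ P, σ (p.1.coeff p.2) ≠ 0 := by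
    intro K _ σ hσ
    refine ⟨fun a ha => hσ.1 a (Ideal.mk_ker.le ha), ?_⟩
    have := hσ.2
    rw [map_prod] at this
    exact Finset.prod_ne_zero_iff.1 this
  refine ⟨P.image Prod.fst, ∏ p ∈ P, p.1.coeff p.2, ?_, ?_, ?_, ?_⟩
  · rw [Ideal.IsPrime.prod_mem_iff]
    rintro ⟨p, hp, hpQ⟩
    refine mem_support_iff.1 (hP p hp).2.1 ?_
    rw [coeff_map]
    exact Ideal.Quotient.eq_zero_iff_mem.2 hpQ
  · intro g hg
    obtain ⟨p, hp, rfl⟩ := Finset.mem_image.1 hg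
    exact (hP p hp).1
  · intro K _ σ hσ
    obtain ⟨hker, hc⟩ := hstr K σ hσ
    obtain ⟨p, hp⟩ := hne
    refine ⟨⟨p.1, (hP p hp).1, ((hP p hp).2.map_of_ker_le hker (hc p hp)).ne_zero⟩, ?_⟩
    rw [Finset.coe_image]
    exact isStandardBasis_map ord hker hP hPA hc
  · intro g hg
    obtain ⟨p, hp, rfl⟩ := Finset.mem_image.1 hg
    refine ⟨p.2, fun K _ σ hσ => ?_⟩
    obtain ⟨hker, hc⟩ := hstr K σ hσ
    exact (hP p hp).2.map_of_ker_le hker (hc p hp)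

/-- Noetherian induction on closed subsets of the spectrum: every `V(Q)` is covered by finitely
many strata and `V(coeffIdeal J)`. -/
lemma exists_finite_strata_cover [IsNoetherianRing C] (hJ : J.FG) (Q : Ideal C) :
    ∃ L : List (Finset (MvPolynomial (Fin n) C) × Ideal C × C),
      (∀ t ∈ L, IsStdStratum.{u, v} ord J t.1 t.2.1 t.2.2) ∧
      ∀ p : Ideal C, p.IsPrime → Q ≤ p → coeffIdeal J ≤ p ∨ ∃ t ∈ L, t.2.1 ≤ p ∧ t.2.2 ∉ p := by
  induction Q using WellFoundedGT.induction with
  | ind Q ih =>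
    by_cases hI : coeffIdeal J ≤ Q
    · exact ⟨[], by simp, fun p _ hQp => Or.inl (hI.trans hQp)⟩
    by_cases htop : Q = ⊤
    · exact ⟨[], by simp, fun p hp hQp => absurd (top_le_iff.1 (htop ▸ hQp)) hp.ne_top⟩
    have hlt : ∀ a ∉ Q, Q < Q ⊔ Ideal.span {a} := fun a ha =>
      lt_of_le_of_ne le_sup_left fun h => ha
        (h ▸ Ideal.mem_sup_right (Ideal.mem_span_singleton_self a))
    have hsup : ∀ {a : C} {p : Ideal C}, Q ≤ p → a ∈ p → Q ⊔ Ideal.span {a} ≤ p := fun hQp ha =>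
      sup_le hQp ((Ideal.span_singleton_le_iff_mem _).2 ha)
    by_cases hprime : Q.IsPrime
    · obtain ⟨G, h, hh, hG⟩ := exists_isStdStratum.{u, v} ord hJ Q hI
      obtain ⟨L, hL, hcov⟩ := ih _ (hlt h hh)
      refine ⟨(G, Q, h) :: L, List.forall_mem_cons.2 ⟨hG, hL⟩, fun p hp hQp => ?_⟩
      by_cases hhp : h ∈ p
      · refine (hcov p hp (hsup hQp hhp)).imp_right ?_
        rintro ⟨t, ht, h'⟩
        exact ⟨t, List.mem_cons_of_mem _ ht, h'⟩
      · exact Or.inr ⟨_, List.mem_cons_self, hQp, hhp⟩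
    · obtain ⟨a, ha, b, hb, hab⟩ : ∃ a ∉ Q, ∃ b ∉ Q, a * b ∈ Q := by
        by_contra! hcon
        refine hprime ⟨htop, fun {a b} hab => ?_⟩
        by_contra! h
        exact hcon a h.1 b h.2 hab
      obtain ⟨L₁, hL₁, hcov₁⟩ := ih _ (hlt a ha)
      obtain ⟨L₂, hL₂, hcov₂⟩ := ih _ (hlt b hb)
      refine ⟨L₁ ++ L₂, fun t ht => (List.mem_append.1 ht).elim (hL₁ t) (hL₂ t),
        fun p hp hQp => ?_⟩
      rcases hp.mem_or_mem (hQp hab) with h | h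
      · refine (hcov₁ p hp (hsup hQp h)).imp_right ?_
        rintro ⟨t, ht, h'⟩
        exact ⟨t, List.mem_append_left _ ht, h'⟩
      · refine (hcov₂ p hp (hsup hQp h)).imp_right ?_
        rintro ⟨t, ht, h'⟩
        exact ⟨t, List.mem_append_right _ ht, h'⟩

end Strata

end ParamStdBasis

theorem mainTheorem2 {C : Type u} [CommRing C] [IsDomain C] [IsNoetherianRing C]
    (n : ℕ) (hn : 0 < n) (ord : ParamStdBasis.MonOrder n)
    (J : Ideal (MvPolynomial (Fin n) C)) (hJ : J.FG) :
    ∃ (s : ℕ) (G : Fin s → Finset (MvPolynomial (Fin n) C)) (Q : Fin s → Ideal C)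
      (h : Fin s → C) (I : Ideal C),
      (∀ k, ∀ g ∈ G k, g ∈ J) ∧
      (⋃ k, PrimeSpectrum.zeroLocus (Q k : Set C) \ PrimeSpectrum.zeroLocus {h k}) ∪
        PrimeSpectrum.zeroLocus (I : Set C) = Set.univ ∧
      (∀ (K : Type v) [Field K] (σ : C →+* K),
        (∀ a ∈ I, σ a = 0) → ∀ f ∈ J, MvPolynomial.map σ f = 0) ∧
      (∀ k,
        (∀ (K : Type v) [Field K] (σ : C →+* K), ParamStdBasis.InStratum (Q k) (h k) σ →
          (∃ f ∈ J, MvPolynomial.map σ f ≠ 0) ∧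
          ParamStdBasis.IsStandardBasis ord (J.map (MvPolynomial.map σ))
            (MvPolynomial.map σ '' (G k : Set (MvPolynomial (Fin n) C)))) ∧
        (∀ g ∈ G k, ∃ α : Fin n →₀ ℕ, ∀ (K : Type v) [Field K] (σ : C →+* K),
          ParamStdBasis.InStratum (Q k) (h k) σ →
          ParamStdBasis.IsLeadingExp ord (MvPolynomial.map σ g) α)) := by
  open ParamStdBasis in
  obtain ⟨L, hL, hcov⟩ := exists_finite_strata_cover.{u, v} ord hJ ⊥
  refine ⟨L.length, fun k => (L.get k).1, fun k => (L.get k).2.1, fun k => (L.get k).2.2,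
    coeffIdeal J, fun k => (hL _ (L.get_mem k)).1, ?_, ?_, fun k => (hL _ (L.get_mem k)).2⟩
  · refine Set.eq_univ_of_forall fun p => ?_
    rcases hcov p.asIdeal p.isPrime bot_le with h | ⟨t, ht, hle, hnot⟩
    · exact Or.inr h
    · obtain ⟨k, rfl⟩ := List.get_of_mem ht
      exact Or.inl (Set.mem_iUnion.2 ⟨k, hle, by simpa using hnot⟩)
  · intro K _ σ hσ f hf
    ext α
    rw [MvPolynomial.coeff_map, MvPolynomial.coeff_zero]
    exact hσ _ (coeff_mem_coeffIdeal hf α)
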